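/- **Setting.** A component maintenance game with $n$ agents is given by a system function $\phi:\{0,1\}^n\to\{0,1\}$, a common belief $\theta$ (a probability distribution on $\{0,1\}^n$) about which components work, and repair costs $C_1,\dots,C_n\in\mathbb{R}$. Each agent chooses $s_i\in\{0,1\}$ ($1$ = repair). With a uniform subsidy $\sigma\ge 0$ for repair, agent $i$ has cost $\mathrm{cost}_i^\sigma(s)=(C_i-\sigma)s_i+1-\mathbb{E}_{x\sim\theta}[\phi(x')]$, where $x'_j=\max\{x_j,s_j\}$. Let $\mathcal{S}_{NE}(\sigma)$ be the (nonempty) set of pure Nash equilibria, $n_s=\sum_i s_i$, and $$L_{\mathrm{prior}}(\sigma)=\max_{s\in\mathcal{S}_{NE}(\sigma)}\Big(\sum_i\mathrm{cost}_i^\sigma(s)+n_s\sigma\Big).$$ Let $H,\kappa>0$. An adversary fixes $T$ games with $n$ agents: arbitrary $(\phi_t,\theta_t)$, and random cost vectors $C^{(t)}=(C^{(t)}_1,\dots,C^{(t)}_n)$ that are independent over $t=1,\dots,T$ and such that each single cost $C^{(t)}_i$ has a probability density bounded by $\kappa$. Let $L_t(\sigma)$ be the loss $L_{\mathrm{prior}}(\sigma)$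 of the $t$-th game, and suppose that almost surely $L_t(\sigma)\in[0,(2H+1)n]$ for all $t$ and all $\sigma\in[0,H]$. **Theorem.** 1. (*Dispersion.*) The losses are $\tfrac12$-dispersed on $[0,H]$, with Lipschitz constant $0$: for all $n,H,\kappa$ there are constants $c>0$ and $p\in\mathbb{N}$ such that for all $T$, all such sequences of games and all $\epsilon\ge T^{-1/2}$, $$\mathbb{E}\Big[\max_{\rho,\rho'\in[0,H],\,|\rho-\rho'|\le\epsilon}\big|\{t: L_t(\rho)\ne L_t(\rho')\}\big|\Big]\le c\,\epsilon\,T\,\log^p(2+T).$$ (The expectation is understood as an outer expectation, so that no measurability of the maximum is needed.) 2. (*Regret.*) The Exponential Forecaster with step size $\lambda$ draws $\sigma_t\in[0,H]$ in round $t$ with fresh randomness from the density proportional to $\exp\big(-\lambda\sum_{r<t}L_r(\sigma)\big)$. There are universal constants $c>0$ and $p\in\mathbb{N}$ such that for all $n,T,H,\kappa$ there is a step size $\lambda>0$, depending only on $n,T,H,\kappa$, for which, for all such sequences of games, the regret has a well-defined expectation (over the costs and the draws) with $$\mathbb{E}\Big[\sum_{t=1}^T L_t(\sigma_t)-\min_{\sigma\in[0,H]}\sum_{t=1}^T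 L_t(\sigma)\Big]\le c\,(2H+1)n\cdot\sqrt{nT}\cdot\log^p(2+n+T+H+\kappa).$$ That is, the expected regret is $\tilde O(\sqrt{nT})$ in units of the length $(2H+1)n$ of the loss range. -/

import Mathlib

open MeasureTheory ProbabilityTheory Set
open scoped ENNReal

noncomputable section

/-- The part of a component maintenance game with `n` agents that does not involve repair costs:
the system function `φ` (an arbitrary boolean function of the component states) and the common
belief `θ` about the component states (an arbitrary joint law; independent components are the
special case of a product law). -/
structure MaintenanceSystem (n : ℕ) where
  φ : (Fin n → Bool) → Bool
  θ : PMF (Fin n → Bool)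

namespace MaintenanceSystem

variable {n : ℕ}

/-- `E_{x ∼ θ} [φ(x')]`, where `x'_i = max {x_i, s_i}` is the state of component `i` after the
agents have played `s`; here `s i = true` means that agent `i` repairs. -/
def workProb (G : MaintenanceSystem n) (s : Fin n → Bool) : ℝ :=
  ∑ x : Fin n → Bool, (G.θ x).toReal * (if G.φ (fun i => x i || s i) then 1 else 0)

/-- Expected cost `C_i s_i + 1 - E_{x ∼ θ} [φ(x')]` of agent `i` in the joint action `s`. -/
def cost (G : MaintenanceSystem n) (C : Fin n → ℝ) (i : Fin n) (s : Fin n → Bool) : ℝ :=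
  (if s i then C i else 0) + 1 - G.workProb s

/-- Cost of agent `i` when every repairing agent receives the uniform subsidy `σ`. -/
def subsidizedCost (G : MaintenanceSystem n) (C : Fin n → ℝ) (σ : ℝ) (i : Fin n)
    (s : Fin n → Bool) : ℝ :=
  G.cost C i s - (if s i then σ else 0)

/-- `s` is a pure Nash equilibrium of the game with uniform subsidy `σ`. -/
def IsNash (G : MaintenanceSystem n) (C : Fin n → ℝ) (σ : ℝ) (s : Fin n → Bool) : Prop :=
  ∀ (i : Fin n) (a : Bool),
    G.subsidizedCost C σ i s ≤ G.subsidizedCost C σ i (Function.update s i a)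

/-- Number of agents that choose repair in `s`. -/
def numRepairs (s : Fin n → Bool) : ℕ := (Finset.univ.filter fun i => s i = true).card

/-- `L_prior(σ) = max_{s ∈ NE(σ)} cost^σ(s) + n_s σ`. The maximum runs over a finite set, which is
nonempty by `exists_isNash` below. -/
def priorLoss (G : MaintenanceSystem n) (C : Fin n → ℝ) (σ : ℝ) : ℝ :=
  sSup ((fun s => (∑ i, G.subsidizedCost C σ i s) + numRepairs s * σ) '' {s | G.IsNash C σ s})

/-- A pure Nash equilibrium exists for every subsidy. -/
theorem exists_isNash (G : MaintenanceSystem n) (C : Fin n → ℝ) (σ : ℝ) :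
    ∃ s, G.IsNash C σ s := by
  obtain ⟨s, hs⟩ := Finite.exists_min
    (fun s : Fin n → Bool => (∑ i, if s i then C i - σ else 0) - G.workProb s)
  refine ⟨s, fun i a => ?_⟩
  have h := hs (Function.update s i a)
  have e1 := Finset.add_sum_erase Finset.univ
    (fun j => if s j then C j - σ else 0) (Finset.mem_univ i)
  have e2 := Finset.add_sum_erase Finset.univ
    (fun j => if Function.update s i a j then C j - σ else 0) (Finset.mem_univ i)
  have e3 : ∑ j ∈ Finset.univ.erase i, (if Function.update s i a j then C j - σ else 0)
      = ∑ j ∈ Finset.univ.erase i, (if s j then C j - σ else 0) :=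
    Finset.sum_congr rfl fun j hj => by
      rw [Function.update_of_ne (Finset.ne_of_mem_erase hj)]
  simp only [Function.update_self] at e2
  simp only [subsidizedCost, cost, Function.update_self]
  rw [← e1, ← e2, e3] at h
  cases a <;> cases hsi : s i <;> simp [hsi] at h ⊢ <;> linarith

/-- `L_prior(σ)` is the genuine maximum over the Nash equilibria. -/
theorem isGreatest_priorLoss (G : MaintenanceSystem n) (C : Fin n → ℝ) (σ : ℝ) :
    IsGreatest
      ((fun s => (∑ i, G.subsidizedCost C σ i s) + numRepairs s * σ) '' {s | G.IsNash C σ s})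
      (G.priorLoss C σ) := by
  have hfin := (Set.toFinite {s | G.IsNash C σ s}).image
    (fun s => (∑ i, G.subsidizedCost C σ i s) + numRepairs s * σ)
  have hne : ((fun s => (∑ i, G.subsidizedCost C σ i s) + numRepairs s * σ) ''
      {s | G.IsNash C σ s}).Nonempty := Set.Nonempty.image _ (G.exists_isNash C σ)
  exact ⟨hne.csSup_mem hfin, fun x hx => le_csSup hfin.bddAbove hx⟩

end MaintenanceSystem

/-- `μ` has a probability density with respect to Lebesgue measure that is at most `κ`. -/
def HasBoundedDensity (μ : Measure ℝ) (κ : ℝ) : Prop :=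
  ∃ f : ℝ → ℝ≥0∞, Measurable f ∧ (∀ x, f x ≤ ENNReal.ofReal κ) ∧ μ = volume.withDensity f

/-- A sequence of `T` component maintenance games with `n` agents, chosen by an oblivious adversary:
the systems are arbitrary, the cost vectors are independent across rounds, and every single repair
cost has a `κ`-bounded density (costs within one round may depend on each other). The losses take
values in `[0, (2H+1)n]` for subsidies in `[0, H]`. -/
structure SmoothGameSequence (n T : ℕ) (H κ : ℝ) {Ω : Type*} [MeasurableSpace Ω]
    (P : Measure Ω) where
  system : Fin T → MaintenanceSystem n
  repairCost : Fin T → Ω → (Fin n → ℝ)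
  measurable_repairCost : ∀ t, Measurable (repairCost t)
  indep : iIndepFun repairCost P
  smooth : ∀ t i, HasBoundedDensity (P.map fun ω => repairCost t ω i) κ
  range : ∀ᵐ ω ∂P, ∀ t, ∀ σ ∈ Icc 0 H,
    (system t).priorLoss (repairCost t ω) σ ∈ Icc 0 ((2 * H + 1) * n)

/-- The realized loss function of round `t`, as a function of the uniform subsidy. -/
def SmoothGameSequence.loss {n T : ℕ} {H κ : ℝ} {Ω : Type*} [MeasurableSpace Ω] {P : Measure Ω}
    (𝒢 : SmoothGameSequence n T H κ P) (ω : Ω) (t : Fin T) (σ : ℝ) : ℝ :=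
  (𝒢.system t).priorLoss (𝒢.repairCost t ω) σ

/-- Outer expectation, which makes sense without measurability of `f`. -/
def outerExpectation {Ω : Type*} [MeasurableSpace Ω] (P : Measure Ω) (f : Ω → ℝ≥0∞) : ℝ≥0∞ :=
  ⨅ (g : Ω → ℝ≥0∞) (_ : Measurable g) (_ : ∀ ω, f ω ≤ g ω), ∫⁻ ω, g ω ∂P

/-- On measurable functions the outer expectation is the expectation. -/
theorem outerExpectation_eq_lintegral {Ω : Type*} [MeasurableSpace Ω] (P : Measure Ω)
    {f : Ω → ℝ≥0∞} (hf : Measurable f) : outerExpectation P f = ∫⁻ ω, f ω ∂P :=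
  le_antisymm (iInf_le_of_le f (iInf_le_of_le hf (iInf_le_of_le (fun _ => le_rfl) le_rfl)))
    (le_iInf fun _ => le_iInf fun _ => le_iInf fun h => lintegral_mono h)

/-- The maximal number of rounds `t` with `|L_t(ρ) - L_t(ρ')| > ℓ |ρ - ρ'|`, over all pairs of
points `ρ, ρ'` of the domain at distance at most `ε`. -/
def maxNonLipschitz {T : ℕ} (dom : Set ℝ) (ℓ ε : ℝ) (L : Fin T → ℝ → ℝ) : ℝ≥0∞ :=
  ⨆ (ρ ∈ dom) (ρ' ∈ dom) (_ : |ρ - ρ'| ≤ ε),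
    (({t : Fin T | ℓ * |ρ - ρ'| < |L t ρ - L t ρ'|}.ncard : ℕ) : ℝ≥0∞)

/-- `β`-dispersion of `T` random loss functions for the Lipschitz constant `ℓ`, with the
`Õ(ε T)` bound made explicit as `c ε T (log (2 + T)) ^ p`. -/
def IsDispersed {T : ℕ} {Ω : Type*} [MeasurableSpace Ω] (P : Measure Ω) (dom : Set ℝ)
    (β ℓ c : ℝ) (p : ℕ) (L : Ω → Fin T → ℝ → ℝ) : Prop :=
  ∀ ε : ℝ, (T : ℝ) ^ (-β) ≤ ε →
    outerExpectation P (fun ω => maxNonLipschitz dom ℓ ε (L ω)) ≤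
      ENNReal.ofReal (c * (ε * T) * Real.log (2 + T) ^ p)

/-- The distribution on `[0, H]` from which the Exponential Forecaster with step size `lam` draws in
round `t`: its density is proportional to `exp (-lam ∑_{r < t} L_r(σ))`. -/
def expForecaster {T : ℕ} (H lam : ℝ) (L : Fin T → ℝ → ℝ) (t : Fin T) : Measure ℝ :=
  (volume.restrict (Icc 0 H)).tilted
    (fun σ => -lam * ∑ r ∈ Finset.univ.filter (fun r => r < t), L r σ)

/-- The joint law of the subsidies drawn by the Exponential Forecaster in the `T` rounds, given the
loss functions: every round uses fresh randomness. -/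
def expForecasterPlay {T : ℕ} (H lam : ℝ) (L : Fin T → ℝ → ℝ) : Measure (Fin T → ℝ) :=
  Measure.pi (expForecaster H lam L)

/-- Regret of the subsidies `σ` against the best fixed subsidy in `[0, H]` in hindsight. -/
def regret {T : ℕ} (H : ℝ) (L : Fin T → ℝ → ℝ) (σ : Fin T → ℝ) : ℝ :=
  ∑ t, L t (σ t) - sInf ((fun ρ => ∑ t, L t ρ) '' Icc 0 H)

end

/-! Subsidies are transfers: in `priorLoss` the term `numRepairs s * σ` cancels what the agents
receive, so the loss is the largest unsubsidized total cost over the equilibria and `σ` enters only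
through the equilibrium set. That set can change only when `σ` crosses one of at most `2 ^ n * n`
thresholds, each a repair cost shifted by a constant. Hence every loss is piecewise constant, and an
interval of length `r` contains a threshold of a given round with probability at most `2 ^ n * n * κ
* r`.

For dispersion, `[0, H]` is covered by about `H / r` overlapping windows. The number of rounds with
a threshold in a fixed window is a sum of independent indicators, and a log-sum-exp bound controls
the expected maximum over windows (`exists_measurable_max_count_le`). Dependence of costs within a
round is harmless, since only a union bound is used there.

For regret, the total weight of the Exponential Forecaster is bounded above by the usual telescoping
product (`integral_exp_neg_mul_sum_le`) and below by the weight of an interval of length `r` around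
a comparator, on which few losses change (`le_integral_exp_neg_mul_sum`). Taking `r` of order `H /
(2 ^ n * n * H * κ * T)` makes the expected number of thresholds per window bounded, while `log (H /
r)` is of order `n` up to logarithms; this is the source of `√(nT)`. If `T ≤ n`, the trivial bound
suffices. -/

noncomputable section

/-! ### Equilibria and thresholds. -/

namespace MaintenanceSystem

variable {n : ℕ}

/-- The subsidy at which agent `i` is indifferent between its actions when the others play `s`. -/
def threshold (G : MaintenanceSystem n) (C : Fin n → ℝ) (s : Fin n → Bool) (i : Fin n) : ℝ :=
  C i - (G.workProb (Function.update s i true) - G.workProb (Function.update s i false))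

theorem isNash_iff (G : MaintenanceSystem n) (C : Fin n → ℝ) (σ : ℝ) (s : Fin n → Bool) :
    G.IsNash C σ s ↔
      ∀ i, (s i = true → G.threshold C s i ≤ σ) ∧ (s i = false → σ ≤ G.threshold C s i) := by
  refine forall_congr' fun i => ?_
  have hs : Function.update s i (s i) = s := Function.update_eq_self i s
  simp only [Bool.forall_bool, subsidizedCost, cost, Function.update_self, threshold]
  cases h : s i <;> rw [h] at hs <;> rw [hs] <;> simp <;>
    constructor <;> intro _ <;> linarith

/-- A threshold outside the closed interval compares with both endpoints in the same way, so no
best-response condition changes. -/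
theorem isNash_congr (G : MaintenanceSystem n) (C : Fin n → ℝ) {ρ ρ' : ℝ} (hρ : ρ ≤ ρ')
    (h : ∀ s i, G.threshold C s i ∉ Icc ρ ρ') (s : Fin n → Bool) :
    G.IsNash C ρ s ↔ G.IsNash C ρ' s := by
  simp only [isNash_iff]
  refine forall_congr' fun i => ?_
  have hi := h s i
  simp only [mem_Icc, not_and_or, not_le] at hi
  rcases hi with hi | hi
  · exact and_congr (imp_congr_right fun _ => ⟨fun _ => by linarith, fun _ => by linarith⟩)
      (imp_congr_right fun _ => ⟨fun _ => by linarith, fun _ => by linarith⟩)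
  · exact and_congr (imp_congr_right fun _ => ⟨fun _ => by linarith, fun _ => by linarith⟩)
      (imp_congr_right fun _ => ⟨fun _ => by linarith, fun _ => by linarith⟩)

theorem sum_subsidizedCost_add (G : MaintenanceSystem n) (C : Fin n → ℝ) (σ : ℝ)
    (s : Fin n → Bool) :
    (∑ i, G.subsidizedCost C σ i s) + numRepairs s * σ = ∑ i, G.cost C i s := by
  simp only [subsidizedCost, numRepairs, Finset.sum_sub_distrib, Finset.sum_ite,
    Finset.sum_const, nsmul_eq_mul]
  simp

/-- After the transfers cancel, `σ` survives only in `IsNash`. This superlevel form yields both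
piecewise constancy and semicontinuity. -/
theorem le_priorLoss_iff (G : MaintenanceSystem n) (C : Fin n → ℝ) (σ a : ℝ) :
    a ≤ G.priorLoss C σ ↔ ∃ s, G.IsNash C σ s ∧ a ≤ ∑ i, G.cost C i s := by
  obtain ⟨⟨s, hs, hsv⟩, hub⟩ := G.isGreatest_priorLoss C σ
  constructor
  · intro h
    refine ⟨s, hs, ?_⟩
    rw [← sum_subsidizedCost_add]
    exact h.trans hsv.ge
  · rintro ⟨s', hs', h⟩
    rw [← sum_subsidizedCost_add (σ := σ)] at h
    exact h.trans (hub ⟨s', hs', rfl⟩)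

theorem exists_threshold_mem_of_priorLoss_ne (G : MaintenanceSystem n) (C : Fin n → ℝ) {ρ ρ' : ℝ}
    (hρ : ρ ≤ ρ') (h : G.priorLoss C ρ ≠ G.priorLoss C ρ') :
    ∃ s i, G.threshold C s i ∈ Icc ρ ρ' := by
  by_contra! hcon
  refine h (eq_of_forall_le_iff fun a => ?_)
  simp only [le_priorLoss_iff, isNash_congr G C hρ hcon]

/-! ### Semicontinuity and measurability of the loss. -/

theorem continuous_threshold (G : MaintenanceSystem n) (s : Fin n → Bool) (i : Fin n) :
    Continuous fun C => G.threshold C s i := by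
  unfold threshold
  fun_prop

theorem continuous_cost (G : MaintenanceSystem n) (s : Fin n → Bool) (i : Fin n) :
    Continuous fun C => G.cost C i s := by
  unfold cost
  cases s i <;> simp <;> fun_prop

theorem isClosed_setOf_isNash (G : MaintenanceSystem n) (s : Fin n → Bool) :
    IsClosed {p : (Fin n → ℝ) × ℝ | G.IsNash p.1 p.2 s} := by
  simp only [isNash_iff, ofPred_forall, ofPred_and]
  have hc : ∀ i, Continuous fun p : (Fin n → ℝ) × ℝ => G.threshold p.1 s i :=
    fun i => (G.continuous_threshold s i).comp continuous_fst
  exact isClosed_iInter fun i =>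
    (isClosed_iInter fun _ => isClosed_le (hc i) continuous_snd).inter
      (isClosed_iInter fun _ => isClosed_le continuous_snd (hc i))

/-- Best-response conditions are weak inequalities, so each superlevel set is a finite union of
closed sets. -/
theorem upperSemicontinuous_priorLoss (G : MaintenanceSystem n) :
    UpperSemicontinuous fun p : (Fin n → ℝ) × ℝ => G.priorLoss p.1 p.2 := by
  rw [upperSemicontinuous_iff_isClosed_preimage]
  intro a
  have : (fun p : (Fin n → ℝ) × ℝ => G.priorLoss p.1 p.2) ⁻¹' Ici a =
      ⋃ s, {p : (Fin n → ℝ) × ℝ | G.IsNash p.1 p.2 s} ∩ {p | a ≤ ∑ i, G.cost p.1 i s} := by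
    ext p
    simp [le_priorLoss_iff]
  rw [this]
  exact isClosed_iUnion_of_finite fun s => (G.isClosed_setOf_isNash s).inter
    (isClosed_le continuous_const
      (continuous_finsetSum _ fun i _ => (G.continuous_cost s i).comp continuous_fst))

theorem measurable_priorLoss (G : MaintenanceSystem n) :
    Measurable fun p : (Fin n → ℝ) × ℝ => G.priorLoss p.1 p.2 :=
  G.upperSemicontinuous_priorLoss.measurable

/-- Makes the infimum over subsidies well behaved for every cost vector; the range assumption bounds
the losses only almost surely. -/
theorem exists_le_priorLoss (G : MaintenanceSystem n) (C : Fin n → ℝ) :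
    ∃ b, ∀ σ, b ≤ G.priorLoss C σ := by
  obtain ⟨s, hs⟩ := Finite.exists_min fun s : Fin n → Bool => ∑ i, G.cost C i s
  refine ⟨_, fun σ => (G.le_priorLoss_iff C σ (∑ i, G.cost C i s)).2 ?_⟩
  obtain ⟨s', hs'⟩ := G.exists_isNash C σ
  exact ⟨s', hs', hs s'⟩

end MaintenanceSystem

/-- Strict sublevel sets are open, so the dense sequence meets every nonempty one; the infimum
becomes countable and hence measurable in a parameter. -/
theorem sInf_image_eq_iInf_denseSeq {X : Type*} [TopologicalSpace X]
    [TopologicalSpace.SeparableSpace X] [Nonempty X] {f : X → ℝ} (hf : UpperSemicontinuous f)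
    (hb : BddBelow (range f)) : sInf (range f) = ⨅ k, f (TopologicalSpace.denseSeq X k) := by
  have hb' : BddBelow (range fun k => f (TopologicalSpace.denseSeq X k)) :=
    hb.mono (range_comp_subset_range _ f)
  refine le_antisymm (le_ciInf fun k => csInf_le hb (mem_range_self _))
    (le_csInf (range_nonempty f) ?_)
  rintro _ ⟨x, rfl⟩
  refine le_of_forall_gt fun c hc => ?_
  obtain ⟨_, hy, k, rfl⟩ := (TopologicalSpace.denseRange_denseSeq X).inter_open_nonempty _
    (hf.isOpen_preimage c) ⟨x, hc⟩
  exact (ciInf_le hb' k).trans_lt hy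

theorem measurable_sInf_image_Icc {Ω : Type*} [MeasurableSpace Ω] {H : ℝ} (hH : 0 ≤ H)
    {f : Ω → ℝ → ℝ} (hm : ∀ σ, Measurable fun ω => f ω σ) (hf : ∀ ω, UpperSemicontinuous (f ω))
    (hb : ∀ ω, ∃ b, ∀ σ, b ≤ f ω σ) : Measurable fun ω => sInf (f ω '' Icc 0 H) := by
  have : Nonempty (Icc 0 H) := ⟨⟨0, le_rfl, hH⟩⟩
  have key : ∀ ω, sInf (f ω '' Icc 0 H)
      = ⨅ k, f ω (TopologicalSpace.denseSeq (Icc 0 H) k : ℝ) := by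
    intro ω
    rw [image_eq_range]
    obtain ⟨b, hb⟩ := hb ω
    exact sInf_image_eq_iInf_denseSeq (f := fun x : Icc 0 H => f ω x)
      (UpperSemicontinuous.comp (hf ω) continuous_subtype_val) ⟨b, by rintro _ ⟨x, rfl⟩; exact hb _⟩
  simp_rw [key]
  exact Measurable.iInf fun k => hm _

namespace SmoothGameSequence

variable {n T : ℕ} {H κ : ℝ} {Ω : Type*} [MeasurableSpace Ω] {P : Measure Ω}

theorem measurable_uncurry_loss (𝒢 : SmoothGameSequence n T H κ P) (t : Fin T) :
    Measurable fun p : Ω × ℝ => 𝒢.loss p.1 t p.2 := by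
  have h : Measurable fun p : Ω × ℝ => (𝒢.repairCost t p.1, p.2) :=
    ((𝒢.measurable_repairCost t).comp measurable_fst).prodMk measurable_snd
  have h' := (𝒢.system t).measurable_priorLoss.comp h
  exact h'

theorem measurable_loss (𝒢 : SmoothGameSequence n T H κ P) (t : Fin T) (σ : ℝ) :
    Measurable fun ω => 𝒢.loss ω t σ := by
  have h : Measurable fun ω : Ω => (ω, σ) := measurable_id.prodMk measurable_const
  have h' := (𝒢.measurable_uncurry_loss t).comp h
  exact h'

theorem upperSemicontinuous_loss (𝒢 : SmoothGameSequence n T H κ P) (ω : Ω) (t : Fin T) :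
    UpperSemicontinuous (𝒢.loss ω t) := by
  have h : Continuous fun σ : ℝ => (𝒢.repairCost t ω, σ) := by fun_prop
  have h' := UpperSemicontinuous.comp (𝒢.system t).upperSemicontinuous_priorLoss h
  exact h'

theorem measurable_sInf_loss (𝒢 : SmoothGameSequence n T H κ P) (hH : 0 ≤ H) :
    Measurable fun ω => sInf ((fun ρ => ∑ t, 𝒢.loss ω t ρ) '' Icc 0 H) := by
  refine measurable_sInf_image_Icc hH (fun σ => ?_)
    (fun ω => upperSemicontinuous_sum fun t _ => 𝒢.upperSemicontinuous_loss ω t) fun ω => ?_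
  · exact Finset.measurable_sum _ fun t _ => 𝒢.measurable_loss t σ
  · choose b hb using fun t => (𝒢.system t).exists_le_priorLoss (𝒢.repairCost t ω)
    exact ⟨∑ t, b t, fun σ => Finset.sum_le_sum fun t _ => hb t σ⟩

end SmoothGameSequence

/-! ### Interval probabilities and maxima of counts. -/

theorem HasBoundedDensity.measure_Icc_le {μ : Measure ℝ} {κ : ℝ} (h : HasBoundedDensity μ κ)
    (a b : ℝ) : μ (Icc a b) ≤ ENNReal.ofReal κ * ENNReal.ofReal (b - a) := by
  obtain ⟨f, -, hf, rfl⟩ := h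
  rw [withDensity_apply _ measurableSet_Icc, ← Real.volume_Icc, ← setLIntegral_const]
  exact lintegral_mono fun x => hf x

theorem outerExpectation_le {Ω : Type*} [MeasurableSpace Ω] {P : Measure Ω} {f g : Ω → ℝ≥0∞}
    (hg : Measurable g) (h : ∀ ω, f ω ≤ g ω) : outerExpectation P f ≤ ∫⁻ ω, g ω ∂P :=
  iInf_le_of_le g (iInf_le_of_le hg (iInf_le_of_le h le_rfl))

/-- The maximum over `j ≤ m` of the number of rounds `t` with `E t j` is controlled by a smooth
maximum of small expectation, if the rounds are independent and all probabilities at most `p`. -/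
theorem exists_measurable_max_count_le {Ω : Type*} [MeasurableSpace Ω] {P : Measure Ω}
    [IsProbabilityMeasure P] {T : ℕ} {β : Type*} [MeasurableSpace β] {X : Fin T → Ω → β}
    (hX : ∀ t, Measurable (X t)) (hind : iIndepFun X P) {m : ℕ} (hm : 0 < m)
    {E : Fin T → Fin m → Set β} (hE : ∀ t j, MeasurableSet (E t j)) {p : ℝ} (hp : 0 ≤ p)
    (hprob : ∀ t j, P.real (X t ⁻¹' E t j) ≤ p) :
    ∃ g : Ω → ℝ, Measurable g ∧ (∀ ω, 0 ≤ g ω) ∧ Integrable g P ∧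
      (∀ ω j, (({t | X t ω ∈ E t j}.ncard : ℕ) : ℝ) ≤ g ω) ∧
      ∫ ω, g ω ∂P ≤ Real.log m + 2 * p * T := by
  classical
  set N : Fin m → Ω → ℝ := fun j => ∑ t, (X t ⁻¹' E t j).indicator 1 with hN
  have hNω : ∀ j ω, N j ω = ∑ t, (E t j).indicator (1 : β → ℝ) (X t ω) := by
    intro j ω
    simp [hN, Finset.sum_apply, indicator]
  have hN0 : ∀ j ω, 0 ≤ N j ω := fun j ω => by
    rw [hNω]
    exact Finset.sum_nonneg fun t _ => indicator_nonneg (fun _ _ => zero_le_one) _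
  have hNT : ∀ j ω, N j ω ≤ T := fun j ω => by
    rw [hNω]
    calc _ ≤ ∑ t : Fin T, (1 : ℝ) :=
          Finset.sum_le_sum fun t _ => indicator_le_self' (fun _ _ => zero_le_one) _
      _ = T := by simp
  have hNcard : ∀ j ω, (({t | X t ω ∈ E t j}.ncard : ℕ) : ℝ) = N j ω := by
    intro j ω
    rw [hNω, Set.ncard_eq_toFinset_card']
    simp [indicator]
  have hNm : ∀ j, Measurable (N j) := fun j => by
    rw [funext (hNω j)]
    exact Finset.measurable_sum _ fun t _ => (measurable_one.indicator (hE t j)).comp (hX t)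
  -- `log S` dominates every count `N j`, and its expectation is accessible through exponential
  -- moments.
  set S : Ω → ℝ := fun ω => ∑ j, Real.exp (N j ω) with hS
  have hSm : Measurable S := Finset.measurable_sum _ fun j _ => (hNm j).exp
  have : Nonempty (Fin m) := ⟨⟨0, hm⟩⟩
  have hS1 : ∀ ω, 1 ≤ S ω := fun ω =>
    (Real.one_le_exp (hN0 ⟨0, hm⟩ ω)).trans
      (Finset.single_le_sum (f := fun j => Real.exp (N j ω)) (fun j _ => (Real.exp_pos _).le)
        (Finset.mem_univ _))
  have hSle : ∀ ω, S ω ≤ m * Real.exp T := fun ω => by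
    calc S ω ≤ ∑ j : Fin m, Real.exp T :=
          Finset.sum_le_sum fun j _ => Real.exp_le_exp.2 (hNT j ω)
      _ = _ := by simp
  have hSi : Integrable S P := Integrable.of_bound hSm.aestronglyMeasurable (m * Real.exp T)
    (ae_of_all _ fun ω => by
      rw [Real.norm_of_nonneg (zero_le_one.trans (hS1 ω))]; exact hSle ω)
  have hgi : Integrable (fun ω => Real.log (S ω)) P :=
    hSi.mono' hSm.log.aestronglyMeasurable (ae_of_all _ fun ω => by
      rw [Real.norm_of_nonneg (Real.log_nonneg (hS1 ω))]
      exact Real.log_le_self (zero_le_one.trans (hS1 ω)))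
  refine ⟨fun ω => Real.log (S ω), hSm.log, fun ω => Real.log_nonneg (hS1 ω), hgi,
    fun ω j => ?_, ?_⟩
  · rw [hNcard, Real.le_log_iff_exp_le (zero_lt_one.trans_le (hS1 ω))]
    exact Finset.single_le_sum (f := fun j => Real.exp (N j ω)) (fun j _ => (Real.exp_pos _).le)
        (Finset.mem_univ _)
  · set a : ℝ := m * Real.exp (2 * p * T) with ha
    have hm' : (0 : ℝ) < m := Nat.cast_pos.2 hm
    have ha0 : 0 < a := by positivity
    have hmgf : ∀ j, ∫ ω, Real.exp (N j ω) ∂P ≤ Real.exp (2 * p * T) := by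
      intro j
      have hind' : iIndepFun (fun t => (X t ⁻¹' E t j).indicator (1 : Ω → ℝ)) P :=
        hind.comp (fun t => (E t j).indicator (1 : β → ℝ))
          fun t => measurable_one.indicator (hE t j)
      have hsum := hind'.mgf_sum (t := 1) (fun t => measurable_one.indicator (hX t (hE t j)))
        Finset.univ
      -- For an indicator of probability `q ≤ p` the moment is `1 + q(e - 1) ≤ 1 + 2p ≤ exp (2p)`.
      have hone : ∀ t, mgf ((X t ⁻¹' E t j).indicator (1 : Ω → ℝ)) P 1 ≤ Real.exp (2 * p) := by
        intro t
        have hexp : ∀ ω, Real.exp (1 * (X t ⁻¹' E t j).indicator (1 : Ω → ℝ) ω) =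
            1 + (X t ⁻¹' E t j).indicator (fun _ => Real.exp 1 - 1) ω := by
          intro ω
          by_cases h : ω ∈ X t ⁻¹' E t j <;> simp [indicator, h]
        rw [mgf]
        simp_rw [hexp]
        rw [integral_add (integrable_const _)
          ((integrable_const _).indicator (hX t (hE t j))),
          integral_indicator (hX t (hE t j))]
        simp only [integral_const, probReal_univ, smul_eq_mul, one_mul, measureReal_restrict_apply,
          MeasurableSet.univ, univ_inter]
        have h1 : Real.exp 1 - 1 ≤ 2 := by linarith [Real.exp_one_lt_d9]
        have h2 := hprob t j
        have h3 : P.real (X t ⁻¹' E t j) * (Real.exp 1 - 1) ≤ p * 2 :=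
          mul_le_mul h2 h1 (by linarith [Real.add_one_le_exp (1 : ℝ)]) hp
        linarith [Real.add_one_le_exp (2 * p)]
      calc ∫ ω, Real.exp (N j ω) ∂P = mgf (N j) P 1 := by simp [mgf]
        _ = ∏ t, mgf ((X t ⁻¹' E t j).indicator (1 : Ω → ℝ)) P 1 := hsum
        _ ≤ ∏ t : Fin T, Real.exp (2 * p) :=
            Finset.prod_le_prod (fun t _ => mgf_nonneg) fun t _ => hone t
        _ = Real.exp (2 * p * T) := by
            rw [Finset.prod_const, ← Real.exp_nat_mul]; simp [mul_comm]
    have hES : ∫ ω, S ω ∂P ≤ a := by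
      rw [hS, integral_finsetSum _ fun j _ => ?_]
      · calc _ ≤ ∑ j : Fin m, Real.exp (2 * p * T) := Finset.sum_le_sum fun j _ => hmgf j
          _ = a := by simp [ha]
      · exact Integrable.of_bound (hNm j).exp.aestronglyMeasurable (Real.exp T)
          (ae_of_all _ fun ω => by
            rw [Real.norm_of_nonneg (Real.exp_pos _).le]; exact Real.exp_le_exp.2 (hNT j ω))
    -- Jensen's inequality via the tangent line of `log` at `a`, the upper bound for the mean of
    -- `S`.
    have hlog : ∀ ω, Real.log (S ω) ≤ Real.log a - 1 + S ω / a := by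
      intro ω
      have hS0 : 0 < S ω := zero_lt_one.trans_le (hS1 ω)
      have := Real.log_le_sub_one_of_pos (div_pos hS0 ha0)
      rw [Real.log_div hS0.ne' ha0.ne'] at this
      linarith
    calc ∫ ω, Real.log (S ω) ∂P ≤ ∫ ω, (Real.log a - 1 + S ω / a) ∂P :=
          integral_mono hgi ((integrable_const _).add (hSi.div_const a)) hlog
      _ = Real.log a - 1 + (∫ ω, S ω ∂P) / a := by
          rw [integral_add (integrable_const _) (hSi.div_const a), integral_div]
          simp
      _ ≤ Real.log a - 1 + 1 := by gcongr; exact (div_le_one ha0).2 hES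
      _ = Real.log m + 2 * p * T := by
          rw [ha, Real.log_mul hm'.ne' (Real.exp_pos _).ne', Real.log_exp]; ring

/-! ### Dispersion of the losses. -/

namespace SmoothGameSequence

variable {n T : ℕ} {H κ : ℝ} {Ω : Type*} [MeasurableSpace Ω] {P : Measure Ω}

/-- The shift `d` does not depend on the costs, so the threshold inherits the density bound of `C
i`. -/
theorem measure_threshold_mem_Icc_le (𝒢 : SmoothGameSequence n T H κ P) (t : Fin T)
    (s : Fin n → Bool) (i : Fin n) (a b : ℝ) :
    P {ω | (𝒢.system t).threshold (𝒢.repairCost t ω) s i ∈ Icc a b} ≤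
      ENNReal.ofReal κ * ENNReal.ofReal (b - a) := by
  set d := (𝒢.system t).workProb (Function.update s i true) -
    (𝒢.system t).workProb (Function.update s i false) with hd
  have hm : Measurable fun ω => 𝒢.repairCost t ω i :=
    (measurable_pi_apply i).comp (𝒢.measurable_repairCost t)
  have h := (𝒢.smooth t i).measure_Icc_le (a + d) (b + d)
  rw [Measure.map_apply hm measurableSet_Icc, add_sub_add_right_eq_sub] at h
  refine le_trans (measure_mono fun ω hω => ?_) h
  simp only [MaintenanceSystem.threshold, ← hd, mem_ofPred_eq, mem_preimage, mem_Icc] at hω ⊢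
  constructor <;> linarith [hω.1, hω.2]

theorem measureReal_exists_threshold_mem_Icc_le (𝒢 : SmoothGameSequence n T H κ P) (hκ : 0 ≤ κ)
    (t : Fin T) {a b : ℝ} (hab : a ≤ b) :
    P.real {ω | ∃ s i, (𝒢.system t).threshold (𝒢.repairCost t ω) s i ∈ Icc a b} ≤
      2 ^ n * n * (κ * (b - a)) := by
  have hset : {ω | ∃ s i, (𝒢.system t).threshold (𝒢.repairCost t ω) s i ∈ Icc a b} =
      ⋃ q : (Fin n → Bool) × Fin n,
        {ω | (𝒢.system t).threshold (𝒢.repairCost t ω) q.1 q.2 ∈ Icc a b} := by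
    ext ω; simp
  rw [hset]
  refine ENNReal.toReal_le_of_le_ofReal (by have := sub_nonneg.2 hab; positivity) ?_
  calc _ ≤ ∑ q : (Fin n → Bool) × Fin n,
        P {ω | (𝒢.system t).threshold (𝒢.repairCost t ω) q.1 q.2 ∈ Icc a b} :=
        measure_iUnion_fintype_le _ _
    _ ≤ ∑ q : (Fin n → Bool) × Fin n, ENNReal.ofReal (κ * (b - a)) :=
        Finset.sum_le_sum fun q _ => by
          rw [ENNReal.ofReal_mul hκ]
          exact 𝒢.measure_threshold_mem_Icc_le t q.1 q.2 a b
    _ = ENNReal.ofReal (2 ^ n * n * (κ * (b - a))) := by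
        rw [Finset.sum_const, ← ENNReal.ofReal_nsmul, nsmul_eq_mul]
        simp

/-- The number of rounds whose loss differs at two subsidies at distance at most `r` is bounded,
uniformly in the two subsidies, by a random variable of small expectation. -/
theorem exists_measurable_loss_ne_count_le [IsProbabilityMeasure P]
    (𝒢 : SmoothGameSequence n T H κ P) (hH : 0 ≤ H) (hκ : 0 ≤ κ) {r : ℝ} (hr : 0 < r) :
    ∃ g : Ω → ℝ, Measurable g ∧ (∀ ω, 0 ≤ g ω) ∧ Integrable g P ∧
      (∀ ω, ∀ ρ ∈ Icc 0 H, ∀ ρ' ∈ Icc 0 H, |ρ - ρ'| ≤ r →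
        (({t | 𝒢.loss ω t ρ ≠ 𝒢.loss ω t ρ'}.ncard : ℕ) : ℝ) ≤ g ω) ∧
      ∫ ω, g ω ∂P ≤ Real.log (H / r + 1) + 4 * (2 ^ n * n * κ * r * T) := by
  set m : ℕ := ⌊H / r⌋₊ + 1 with hm
  -- Windows of length `2 * r` at spacing `r`: any two points at distance at most `r` share the
  -- window indexed by the floor of the smaller one over `r`.
  set E : Fin T → Fin m → Set (Fin n → ℝ) := fun t j =>
    {C | ∃ s i, (𝒢.system t).threshold C s i ∈ Icc (j * r) ((j + 2) * r)} with hE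
  have hEm : ∀ t j, MeasurableSet (E t j) := by
    intro t j
    have : E t j = ⋃ (s) (i), (fun C => (𝒢.system t).threshold C s i) ⁻¹'
        Icc (j * r) ((j + 2) * r) := by
      ext C; simp [hE]
    rw [this]
    exact MeasurableSet.iUnion fun s => MeasurableSet.iUnion fun i =>
      ((𝒢.system t).continuous_threshold s i).measurable measurableSet_Icc
  have hp : ∀ t j, P.real (𝒢.repairCost t ⁻¹' E t j) ≤ 2 ^ n * n * (κ * (2 * r)) := by
    intro t j
    have h := 𝒢.measureReal_exists_threshold_mem_Icc_le hκ t
      (show (j : ℝ) * r ≤ (j + 2) * r by nlinarith)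
    rwa [show ((j : ℝ) + 2) * r - j * r = 2 * r by ring] at h
  obtain ⟨g, hg, hg0, hgi, hcount, hint⟩ := exists_measurable_max_count_le
    𝒢.measurable_repairCost 𝒢.indep (Nat.succ_pos _) hEm (by positivity) hp
  have hle : ∀ ω, ∀ ρ ∈ Icc 0 H, ∀ ρ' ∈ Icc 0 H, |ρ - ρ'| ≤ r → ρ ≤ ρ' →
        (({t | 𝒢.loss ω t ρ ≠ 𝒢.loss ω t ρ'}.ncard : ℕ) : ℝ) ≤ g ω := by
    intro ω ρ hρ ρ' _ hd hρρ'
    have hj : ⌊ρ / r⌋₊ < m :=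
      Nat.lt_succ_of_le (Nat.floor_mono (div_le_div_of_nonneg_right hρ.2 hr.le))
    refine le_trans ?_ (hcount ω ⟨⌊ρ / r⌋₊, hj⟩)
    refine Nat.cast_le.2 (Set.ncard_le_ncard (fun t ht => ?_) (Set.toFinite _))
    obtain ⟨s, i, h1, h2⟩ := (𝒢.system t).exists_threshold_mem_of_priorLoss_ne _ hρρ' ht
    refine ⟨s, i, le_trans ?_ h1, h2.trans ?_⟩
    · exact (le_div_iff₀ hr).1 (Nat.floor_le (div_nonneg hρ.1 hr.le))
    · have := (div_lt_iff₀ hr).1 (Nat.lt_floor_add_one (ρ / r))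
      rw [abs_le] at hd
      simp only
      linarith [hd.1]
  refine ⟨g, hg, hg0, hgi, fun ω ρ hρ ρ' hρ' hd => ?_, hint.trans ?_⟩
  · rcases le_total ρ ρ' with h | h
    · exact hle ω ρ hρ ρ' hρ' hd h
    · simp_rw [ne_comm (a := 𝒢.loss ω _ ρ)]
      exact hle ω ρ' hρ' ρ hρ (by rwa [abs_sub_comm]) h
  · have h1 : (m : ℝ) ≤ H / r + 1 := by
      rw [hm]; push_cast
      linarith [Nat.floor_le (div_nonneg hH hr.le)]
    have h2 : Real.log m ≤ Real.log (H / r + 1) :=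
      Real.log_le_log (by rw [hm]; positivity) h1
    linarith

theorem isDispersed_loss [IsProbabilityMeasure P]
    (𝒢 : SmoothGameSequence n T H κ P) (hH : 0 ≤ H) (hκ : 0 ≤ κ) :
    IsDispersed P (Icc 0 H) (1 / 2) 0 (H + 4 * (2 ^ n * n * κ)) 0 𝒢.loss := by
  intro ε hε
  -- For `T = 0` the power `0 ^ (-1/2)` is `0` by convention, so `ε > 0` is unavailable; there are
  -- no rounds to count.
  rcases Nat.eq_zero_or_pos T with rfl | hT
  · have : (fun ω => maxNonLipschitz (Icc 0 H) 0 ε (𝒢.loss ω)) = fun _ => 0 := by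
      funext ω
      simp [maxNonLipschitz, Set.eq_empty_of_isEmpty]
    rw [this, outerExpectation_eq_lintegral _ measurable_const]
    simp
  have hT' : (0 : ℝ) < T := Nat.cast_pos.2 hT
  have hpos : 0 < (T : ℝ) ^ (-(1 / 2) : ℝ) := Real.rpow_pos_of_pos hT' _
  have hε0 : 0 < ε := hpos.trans_le hε
  obtain ⟨g, hg, hg0, hgi, hcount, hint⟩ := 𝒢.exists_measurable_loss_ne_count_le hH hκ hε0
  refine (outerExpectation_le hg.ennreal_ofReal fun ω => ?_).trans ?_
  · refine iSup₂_le fun ρ hρ => iSup₂_le fun ρ' hρ' => iSup_le fun hd => ?_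
    rw [← ENNReal.ofReal_natCast]
    refine ENNReal.ofReal_le_ofReal ?_
    simpa [sub_eq_zero] using hcount ω ρ hρ ρ' hρ' hd
  · rw [← ofReal_integral_eq_lintegral_ofReal hgi (ae_of_all _ hg0)]
    refine ENNReal.ofReal_le_ofReal (hint.trans ?_)
    have h1 : Real.log (H / ε + 1) ≤ H / ε := by
      have := Real.log_le_sub_one_of_pos (show 0 < H / ε + 1 by positivity)
      linarith
    have h2 : 1 ≤ ε * T * ε := by
      have h3 : (T : ℝ) ^ (-(1 / 2) : ℝ) * (T : ℝ) ^ (-(1 / 2) : ℝ) * T = 1 := by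
        rw [← Real.rpow_add hT', ← Real.rpow_add_one hT'.ne']
        norm_num
      have h4 := mul_le_mul_of_nonneg_right (mul_le_mul hε hε hpos.le hε0.le) hT'.le
      linarith
    have h5 : H / ε ≤ H * (ε * T) := by
      rw [div_le_iff₀ hε0]
      nlinarith
    rw [pow_zero, mul_one]
    linarith

end SmoothGameSequence

/-! ### Exponential weights for fixed losses. -/

theorem Real.exp_neg_le_quadratic {x : ℝ} (hx : 0 ≤ x) : Real.exp (-x) ≤ 1 - x + x ^ 2 / 2 := by
  have h := Real.quadratic_le_exp_of_nonneg hx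
  have hpos : 0 < 1 + x + x ^ 2 / 2 := by positivity
  rw [Real.exp_neg]
  refine (inv_anti₀ hpos h).trans ?_
  rw [inv_le_iff_one_le_mul₀ hpos]
  -- The product `(1 + x + x²/2)(1 - x + x²/2)` equals `1 + x⁴/4`.
  nlinarith [sq_nonneg (x ^ 2)]

theorem integrable_of_mem_Icc {α : Type*} [MeasurableSpace α] {μ : Measure α} [IsFiniteMeasure μ]
    {f : α → ℝ} {R : ℝ} (hf : Measurable f) (hR : ∀ᵐ x ∂μ, f x ∈ Icc 0 R) : Integrable f μ :=
  Integrable.of_bound hf.aestronglyMeasurable R <| by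
    filter_upwards [hR] with x hx
    rw [Real.norm_of_nonneg hx.1]
    exact hx.2

/-- A second-order substitute for Hoeffding's lemma; only the constant in front of `lam ^ 2 * R ^ 2`
is worse. -/
theorem integral_exp_neg_mul_le {α : Type*} [MeasurableSpace α] {μ : Measure α}
    [IsProbabilityMeasure μ] {f : α → ℝ} {R lam : ℝ} (hlam : 0 ≤ lam) (hf : Measurable f)
    (hR : ∀ᵐ x ∂μ, f x ∈ Icc 0 R) :
    ∫ x, Real.exp (-lam * f x) ∂μ ≤ Real.exp (-lam * (∫ x, f x ∂μ) + lam ^ 2 * R ^ 2 / 2) := by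
  have hi := integrable_of_mem_Icc hf hR
  have hle : ∀ᵐ x ∂μ, Real.exp (-lam * f x) ≤ 1 + lam ^ 2 * R ^ 2 / 2 - lam * f x := by
    filter_upwards [hR] with x hx
    have h1 := Real.exp_neg_le_quadratic (mul_nonneg hlam hx.1)
    have h2 : (lam * f x) ^ 2 ≤ lam ^ 2 * R ^ 2 := by
      rw [mul_pow]
      exact mul_le_mul_of_nonneg_left (pow_le_pow_left₀ hx.1 hx.2 2) (sq_nonneg _)
    rw [neg_mul]
    linarith
  have hgi : Integrable (fun x => 1 + lam ^ 2 * R ^ 2 / 2 - lam * f x) μ :=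
    (integrable_const _).sub (hi.const_mul lam)
  calc ∫ x, Real.exp (-lam * f x) ∂μ ≤ ∫ x, (1 + lam ^ 2 * R ^ 2 / 2 - lam * f x) ∂μ :=
        integral_mono_of_nonneg (ae_of_all _ fun x => (Real.exp_pos _).le) hgi hle
    _ = 1 + lam ^ 2 * R ^ 2 / 2 - lam * ∫ x, f x ∂μ := by
        rw [integral_sub (integrable_const _) (hi.const_mul lam), integral_const_mul]
        simp
    _ ≤ _ := by
        have := Real.add_one_le_exp (-lam * (∫ x, f x ∂μ) + lam ^ 2 * R ^ 2 / 2)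
        linarith

section Forecaster

variable {T : ℕ} {H lam R : ℝ} {L : Fin T → ℝ → ℝ}

theorem integrable_exp_neg_mul_sum (hlam : 0 ≤ lam) (hL : ∀ t, Measurable (L t))
    (hR : ∀ t, ∀ σ ∈ Icc 0 H, L t σ ∈ Icc 0 R) (A : Finset (Fin T)) :
    Integrable (fun σ => Real.exp (-lam * ∑ r ∈ A, L r σ)) (volume.restrict (Icc 0 H)) := by
  refine integrable_of_mem_Icc (R := 1)
    ((Finset.measurable_sum _ fun t _ => hL t).const_mul _).exp ?_
  filter_upwards [ae_restrict_mem measurableSet_Icc] with σ hσ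
  refine ⟨(Real.exp_pos _).le, Real.exp_le_one_iff.2 ?_⟩
  rw [neg_mul, neg_nonpos]
  exact mul_nonneg hlam (Finset.sum_nonneg fun t _ => (hR t σ hσ).1)

theorem isProbabilityMeasure_expForecaster (hH : 0 < H) (hlam : 0 ≤ lam)
    (hL : ∀ t, Measurable (L t)) (hR : ∀ t, ∀ σ ∈ Icc 0 H, L t σ ∈ Icc 0 R) (t : Fin T) :
    IsProbabilityMeasure (expForecaster H lam L t) := by
  have : NeZero (volume.restrict (Icc 0 H) : Measure ℝ) :=
    ⟨by rw [Ne, Measure.restrict_eq_zero, Real.volume_Icc]; simpa using hH⟩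
  exact isProbabilityMeasure_tilted (integrable_exp_neg_mul_sum hlam hL hR _)

theorem ae_expForecaster_mem_Icc (t : Fin T) : ∀ᵐ σ ∂(expForecaster H lam L t), σ ∈ Icc 0 H :=
  (tilted_absolutelyContinuous _ _).ae_le (ae_restrict_mem measurableSet_Icc)

theorem integrable_expForecaster (hH : 0 < H) (hlam : 0 ≤ lam)
    (hL : ∀ t, Measurable (L t)) (hR : ∀ t, ∀ σ ∈ Icc 0 H, L t σ ∈ Icc 0 R) (t : Fin T) :
    Integrable (L t) (expForecaster H lam L t) := by
  have := isProbabilityMeasure_expForecaster hH hlam hL hR t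
  exact integrable_of_mem_Icc (hL t) ((ae_expForecaster_mem_Icc t).mono (hR t))

theorem integrable_regret (hH : 0 < H) (hlam : 0 ≤ lam)
    (hL : ∀ t, Measurable (L t)) (hR : ∀ t, ∀ σ ∈ Icc 0 H, L t σ ∈ Icc 0 R) :
    Integrable (regret H L) (expForecasterPlay H lam L) := by
  have := isProbabilityMeasure_expForecaster hH hlam hL hR
  unfold regret expForecasterPlay
  exact (integrable_finsetSum _ fun t _ =>
    integrable_comp_eval (integrable_expForecaster hH hlam hL hR t)).sub (integrable_const _)

theorem integral_regret (hH : 0 < H) (hlam : 0 ≤ lam)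
    (hL : ∀ t, Measurable (L t)) (hR : ∀ t, ∀ σ ∈ Icc 0 H, L t σ ∈ Icc 0 R) :
    ∫ σ, regret H L σ ∂(expForecasterPlay H lam L) =
      ∑ t, ∫ σ, L t σ ∂(expForecaster H lam L t) - sInf ((fun ρ => ∑ t, L t ρ) '' Icc 0 H) := by
  have := isProbabilityMeasure_expForecaster hH hlam hL hR
  have hi : ∀ t, Integrable (fun σ : Fin T → ℝ => L t (σ t))
      (Measure.pi (expForecaster H lam L)) :=
    fun t => integrable_comp_eval (integrable_expForecaster hH hlam hL hR t)
  unfold regret expForecasterPlay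
  rw [integral_sub (integrable_finsetSum _ fun t _ => hi t) (integrable_const _),
    integral_finsetSum _ fun t _ => hi t]
  congr 1
  · exact Finset.sum_congr rfl fun t _ => integral_comp_eval (hL t).aestronglyMeasurable
  · simp

/-- The total weight is multiplied in each round by the forecaster's mean of `exp (-lam * L t)`,
because the forecaster's density is the current normalized weight. -/
theorem integral_exp_neg_mul_sum_le (hH : 0 < H) (hlam : 0 ≤ lam)
    (hL : ∀ t, Measurable (L t)) (hR : ∀ t, ∀ σ ∈ Icc 0 H, L t σ ∈ Icc 0 R) {k : ℕ} (hk : k ≤ T) :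
    ∫ σ in Icc 0 H, Real.exp (-lam * ∑ r with r.val < k, L r σ) ≤
      H * Real.exp (∑ r : Fin T with r.val < k,
        (-lam * (∫ σ, L r σ ∂(expForecaster H lam L r)) + lam ^ 2 * R ^ 2 / 2)) := by
  induction k with
  | zero => simp [hH.le]
  | succ k ih =>
    set t : Fin T := ⟨k, hk⟩ with ht
    have hfil : (Finset.univ.filter fun r : Fin T => r.val < k + 1) =
        insert t (Finset.univ.filter fun r : Fin T => r.val < k) := by
      ext r; simp [ht, Fin.ext_iff]; omega
    have hnot : t ∉ Finset.univ.filter fun r : Fin T => r.val < k := by simp [ht]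
    have hp := isProbabilityMeasure_expForecaster hH hlam hL hR t
    have hmgf := integral_exp_neg_mul_le hlam (hL t)
      ((ae_expForecaster_mem_Icc (lam := lam) (L := L) t).mono (hR t))
    have hV : 0 < ∫ σ in Icc 0 H, Real.exp (-lam * ∑ r with r.val < k, L r σ) := by
      have : NeZero (volume.restrict (Icc 0 H) : Measure ℝ) :=
        ⟨by rw [Ne, Measure.restrict_eq_zero, Real.volume_Icc]; simpa using hH⟩
      exact integral_exp_pos (integrable_exp_neg_mul_sum hlam hL hR _)
    have hstep : ∫ σ in Icc 0 H, Real.exp (-lam * ∑ r with r.val < k + 1, L r σ) =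
        (∫ σ in Icc 0 H, Real.exp (-lam * ∑ r with r.val < k, L r σ)) *
          ∫ σ, Real.exp (-lam * L t σ) ∂(expForecaster H lam L t) := by
      rw [expForecaster, integral_tilted]
      change _ = (∫ σ in Icc 0 H, Real.exp (-lam * ∑ r with r.val < k, L r σ)) *
        ∫ σ in Icc 0 H, (Real.exp (-lam * ∑ r with r.val < k, L r σ) /
          ∫ σ in Icc 0 H, Real.exp (-lam * ∑ r with r.val < k, L r σ)) • Real.exp (-lam * L t σ)
      rw [← integral_const_mul]
      congr 1
      funext σ
      rw [hfil, Finset.sum_insert hnot, mul_add, Real.exp_add, smul_eq_mul, ← mul_assoc,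
        mul_div_cancel₀ _ hV.ne', mul_comm]
    rw [hstep, hfil, Finset.sum_insert hnot, Real.exp_add, mul_comm (Real.exp _), ← mul_assoc]
    exact mul_le_mul (ih (Nat.le_of_succ_le hk)) hmgf
      (integral_nonneg fun _ => (Real.exp_pos _).le) (by positivity)

theorem sum_le_sum_add_mul_ncard (hR : ∀ t, ∀ σ ∈ Icc 0 H, L t σ ∈ Icc 0 R) {σ ρ : ℝ}
    (hσ : σ ∈ Icc 0 H) (hρ : ρ ∈ Icc 0 H) :
    ∑ t, L t σ ≤ ∑ t, L t ρ + R * ({t | L t σ ≠ L t ρ}.ncard : ℕ) := by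
  classical
  have h : ((({t | L t σ ≠ L t ρ} : Set (Fin T)).ncard : ℕ) : ℝ) =
      ∑ t, if L t σ ≠ L t ρ then (1 : ℝ) else 0 := by
    rw [Set.ncard_eq_toFinset_card', Finset.sum_boole]
    simp
  rw [h, Finset.mul_sum, ← Finset.sum_add_distrib]
  refine Finset.sum_le_sum fun t _ => ?_
  split_ifs with h
  · linarith [(hR t σ hσ).2, (hR t ρ hρ).1]
  · simp [not_not.1 h]

/-- On an interval of length `r` containing `ρ`, at most `M` losses differ from their value at `ρ`,
each by at most `R`. -/
theorem le_integral_exp_neg_mul_sum (hlam : 0 ≤ lam) (hL : ∀ t, Measurable (L t))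
    (hR : ∀ t, ∀ σ ∈ Icc 0 H, L t σ ∈ Icc 0 R) (hR0 : 0 ≤ R) {r M : ℝ} (hr : 0 < r) (hrH : r ≤ H)
    (hM : ∀ ρ ∈ Icc 0 H, ∀ ρ' ∈ Icc 0 H, |ρ - ρ'| ≤ r →
      (({t | L t ρ ≠ L t ρ'}.ncard : ℕ) : ℝ) ≤ M) {ρ : ℝ} (hρ : ρ ∈ Icc 0 H) :
    r * Real.exp (-lam * (∑ t, L t ρ + R * M)) ≤
      ∫ σ in Icc 0 H, Real.exp (-lam * ∑ t, L t σ) := by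
  -- Clamping the left endpoint keeps the interval inside `[0, H]` when `ρ` is close to `H`.
  set a := min ρ (H - r) with ha
  have ha0 : 0 ≤ a := le_min hρ.1 (sub_nonneg.2 hrH)
  have haρ : a ≤ ρ := min_le_left _ _
  have haH : a + r ≤ H := by linarith [min_le_right ρ (H - r)]
  have hρa : ρ ≤ a + r := by
    rcases min_choice ρ (H - r) with h | h <;> rw [ha, h] <;> linarith [hρ.2]
  have hsub : Icc a (a + r) ⊆ Icc 0 H := Icc_subset_Icc ha0 haH
  have hint := integrable_exp_neg_mul_sum hlam hL hR Finset.univ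
  calc r * Real.exp (-lam * (∑ t, L t ρ + R * M))
      = ∫ _ in Icc a (a + r), Real.exp (-lam * (∑ t, L t ρ + R * M)) := by
        simp [hr.le]
    _ ≤ ∫ σ in Icc a (a + r), Real.exp (-lam * ∑ t, L t σ) := by
        refine setIntegral_mono_on (integrable_const _)
          (IntegrableOn.mono_set hint hsub) measurableSet_Icc fun σ hσ => ?_
        refine Real.exp_le_exp.2 ?_
        rw [neg_mul, neg_mul, neg_le_neg_iff]
        refine mul_le_mul_of_nonneg_left ?_ hlam
        refine (sum_le_sum_add_mul_ncard hR (hsub hσ) hρ).trans ?_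
        have := hM σ (hsub hσ) ρ hρ (abs_le.2 ⟨by linarith [hσ.1], by linarith [hσ.2]⟩)
        gcongr
    _ ≤ _ := setIntegral_mono_set hint (ae_of_all _ fun _ => (Real.exp_pos _).le)
        hsub.eventuallyLE

/-- Regret of the Exponential Forecaster for losses in `[0, R]`, when at most `M` losses differ at
any two points at distance at most `r`. -/
theorem integral_regret_le (hH : 0 < H) (hlam : 0 < lam) (hL : ∀ t, Measurable (L t))
    (hR : ∀ t, ∀ σ ∈ Icc 0 H, L t σ ∈ Icc 0 R) (hR0 : 0 ≤ R) {r M : ℝ} (hr : 0 < r) (hrH : r ≤ H)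
    (hM : ∀ ρ ∈ Icc 0 H, ∀ ρ' ∈ Icc 0 H, |ρ - ρ'| ≤ r →
      (({t | L t ρ ≠ L t ρ'}.ncard : ℕ) : ℝ) ≤ M) :
    ∫ σ, regret H L σ ∂(expForecasterPlay H lam L) ≤
      Real.log (H / r) / lam + lam * T * R ^ 2 / 2 + R * M := by
  -- The bound is proved against each comparator `ρ` and then passed to the infimum.
  rw [integral_regret hH hlam.le hL hR, sub_le_comm]
  refine le_csInf ((nonempty_Icc.2 hH.le).image _) ?_
  rintro _ ⟨ρ, hρ, rfl⟩
  have h1 := le_integral_exp_neg_mul_sum hlam.le hL hR hR0 hr hrH hM hρ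
  have h2 := integral_exp_neg_mul_sum_le hH hlam.le hL hR le_rfl
  simp only [Fin.is_lt, Finset.filter_true, Finset.sum_add_distrib, ← Finset.mul_sum,
    Finset.sum_const, Finset.card_univ, Fintype.card_fin, nsmul_eq_mul] at h2
  have h3 := Real.log_le_log (by positivity) (h1.trans h2)
  rw [Real.log_mul hr.ne' (Real.exp_pos _).ne', Real.log_mul hH.ne' (Real.exp_pos _).ne',
    Real.log_exp, Real.log_exp] at h3
  rw [Real.log_div hH.ne' hr.ne']
  have h4 : (∑ t, ∫ σ, L t σ ∂(expForecaster H lam L t) - (∑ t, L t ρ + R * M)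
      - lam * T * R ^ 2 / 2) * lam ≤ Real.log H - Real.log r := by
    nlinarith
  have h5 := (le_div_iff₀ hlam).2 h4
  simp only
  linarith

theorem integral_regret_le_mul (hH : 0 < H) (hlam : 0 ≤ lam) (hL : ∀ t, Measurable (L t))
    (hR : ∀ t, ∀ σ ∈ Icc 0 H, L t σ ∈ Icc 0 R) :
    ∫ σ, regret H L σ ∂(expForecasterPlay H lam L) ≤ T * R := by
  have hp := isProbabilityMeasure_expForecaster hH hlam hL hR
  rw [integral_regret hH hlam hL hR]
  have h1 : 0 ≤ sInf ((fun ρ => ∑ t, L t ρ) '' Icc 0 H) := by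
    refine Real.sInf_nonneg ?_
    rintro _ ⟨ρ, hρ, rfl⟩
    exact Finset.sum_nonneg fun t _ => (hR t ρ hρ).1
  have h2 : ∑ t, ∫ σ, L t σ ∂(expForecaster H lam L t) ≤ ∑ _t : Fin T, R := by
    refine Finset.sum_le_sum fun t _ => ?_
    calc _ ≤ ∫ _, R ∂(expForecaster H lam L t) :=
          integral_mono_ae (integrable_expForecaster hH hlam hL hR t) (integrable_const _)
            ((ae_expForecaster_mem_Icc t).mono fun σ hσ => (hR t σ hσ).2)
      _ = R := by simp
  simp only [Finset.sum_const, Finset.card_univ, Fintype.card_fin, nsmul_eq_mul] at h2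
  linarith

theorem neg_le_integral_regret (hH : 0 < H) (hlam : 0 ≤ lam) (hL : ∀ t, Measurable (L t))
    (hR : ∀ t, ∀ σ ∈ Icc 0 H, L t σ ∈ Icc 0 R) :
    -(T * R) ≤ ∫ σ, regret H L σ ∂(expForecasterPlay H lam L) := by
  have hp := isProbabilityMeasure_expForecaster hH hlam hL hR
  rw [integral_regret hH hlam hL hR]
  have h0 : (0 : ℝ) ∈ Icc 0 H := ⟨le_rfl, hH.le⟩
  have h1 : sInf ((fun ρ => ∑ t, L t ρ) '' Icc 0 H) ≤ ∑ t, L t 0 := by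
    refine csInf_le ⟨0, ?_⟩ ⟨0, h0, rfl⟩
    rintro _ ⟨ρ, hρ, rfl⟩
    exact Finset.sum_nonneg fun t _ => (hR t ρ hρ).1
  have h2 : ∑ t, L t 0 ≤ ∑ _t : Fin T, R := Finset.sum_le_sum fun t _ => (hR t 0 h0).2
  have h3 : 0 ≤ ∑ t, ∫ σ, L t σ ∂(expForecaster H lam L t) :=
    Finset.sum_nonneg fun t _ => integral_nonneg_of_ae
      ((ae_expForecaster_mem_Icc t).mono fun σ hσ => (hR t σ hσ).1)
  simp only [Finset.sum_const, Finset.card_univ, Fintype.card_fin, nsmul_eq_mul] at h2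
  linarith

end Forecaster

/-! ### Expected regret over random games. -/

namespace SmoothGameSequence

variable {n T : ℕ} {H κ : ℝ} {Ω : Type*} [MeasurableSpace Ω] {P : Measure Ω}

theorem measurable_loss_right (𝒢 : SmoothGameSequence n T H κ P) (ω : Ω) (t : Fin T) :
    Measurable (𝒢.loss ω t) :=
  (𝒢.upperSemicontinuous_loss ω t).measurable

theorem measurable_integral_expForecaster_loss (𝒢 : SmoothGameSequence n T H κ P) (lam : ℝ)
    (t : Fin T) :
    Measurable fun ω => ∫ σ, 𝒢.loss ω t σ ∂(expForecaster H lam (𝒢.loss ω) t) := by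
  have hw : Measurable fun p : Ω × ℝ =>
      Real.exp (-lam * ∑ r with r < t, 𝒢.loss p.1 r p.2) :=
    ((Finset.measurable_sum _ fun r _ => 𝒢.measurable_uncurry_loss r).const_mul _).exp
  have hZ : Measurable fun ω =>
      ∫ σ in Icc 0 H, Real.exp (-lam * ∑ r with r < t, 𝒢.loss ω r σ) :=
    hw.stronglyMeasurable.integral_prod_right'.measurable
  have hF : Measurable fun p : Ω × ℝ =>
      (Real.exp (-lam * ∑ r with r < t, 𝒢.loss p.1 r p.2) /
        ∫ σ in Icc 0 H, Real.exp (-lam * ∑ r with r < t, 𝒢.loss p.1 r σ)) • 𝒢.loss p.1 t p.2 :=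
    (hw.div (hZ.comp measurable_fst)).smul (𝒢.measurable_uncurry_loss t)
  -- Writing out the tilted density replaces a measure depending on `ω` by a fixed one with a
  -- jointly measurable integrand.
  simp only [expForecaster, integral_tilted]
  exact hF.stronglyMeasurable.integral_prod_right'.measurable

theorem integrable_integral_regret [IsProbabilityMeasure P] (𝒢 : SmoothGameSequence n T H κ P)
    (hH : 0 < H) {lam : ℝ} (hlam : 0 ≤ lam) :
    Integrable
      (fun ω => ∫ σ, regret H (𝒢.loss ω) σ ∂(expForecasterPlay H lam (𝒢.loss ω))) P := by
  have hmeas : AEStronglyMeasurable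
      (fun ω => ∫ σ, regret H (𝒢.loss ω) σ ∂(expForecasterPlay H lam (𝒢.loss ω))) P := by
    refine AEStronglyMeasurable.congr (Measurable.aestronglyMeasurable
      ((Finset.measurable_sum Finset.univ fun t _ =>
        𝒢.measurable_integral_expForecaster_loss lam t).sub (𝒢.measurable_sInf_loss hH.le))) ?_
    filter_upwards [𝒢.range] with ω hω
    exact (integral_regret hH hlam (𝒢.measurable_loss_right ω) hω).symm
  refine Integrable.of_bound hmeas (T * ((2 * H + 1) * n)) ?_
  filter_upwards [𝒢.range] with ω hω
  exact abs_le.2 ⟨neg_le_integral_regret hH hlam (𝒢.measurable_loss_right ω) hω,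
    integral_regret_le_mul hH hlam (𝒢.measurable_loss_right ω) hω⟩

theorem expected_regret_le_mul [IsProbabilityMeasure P] (𝒢 : SmoothGameSequence n T H κ P)
    (hH : 0 < H) {lam : ℝ} (hlam : 0 ≤ lam) :
    ∫ ω, (∫ σ, regret H (𝒢.loss ω) σ ∂(expForecasterPlay H lam (𝒢.loss ω))) ∂P ≤
      T * ((2 * H + 1) * n) := by
  have h := integral_mono_ae (𝒢.integrable_integral_regret hH hlam)
    (integrable_const (T * ((2 * H + 1) * n) : ℝ)) (𝒢.range.mono fun ω hω =>
      integral_regret_le_mul hH hlam (𝒢.measurable_loss_right ω) hω)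
  simpa using h

theorem expected_regret_le [IsProbabilityMeasure P] (𝒢 : SmoothGameSequence n T H κ P)
    (hH : 0 < H) (hκ : 0 ≤ κ) {lam r : ℝ} (hlam : 0 < lam) (hr : 0 < r) (hrH : r ≤ H) :
    ∫ ω, (∫ σ, regret H (𝒢.loss ω) σ ∂(expForecasterPlay H lam (𝒢.loss ω))) ∂P ≤
      Real.log (H / r) / lam + lam * T * ((2 * H + 1) * n) ^ 2 / 2 +
        (2 * H + 1) * n * (Real.log (H / r + 1) + 4 * (2 ^ n * n * κ * r * T)) := by
  obtain ⟨g, -, -, hgi, hcount, hint⟩ := 𝒢.exists_measurable_loss_ne_count_le hH.le hκ hr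
  have hR0 : 0 ≤ (2 * H + 1) * (n : ℝ) := by positivity
  calc _ ≤ ∫ ω, (Real.log (H / r) / lam + lam * T * ((2 * H + 1) * n) ^ 2 / 2 +
        (2 * H + 1) * n * g ω) ∂P :=
        integral_mono_ae (𝒢.integrable_integral_regret hH hlam.le)
          ((integrable_const _).add (hgi.const_mul _)) (𝒢.range.mono fun ω hω =>
            integral_regret_le hH hlam (𝒢.measurable_loss_right ω) hω hR0 hr hrH (hcount ω))
    _ = Real.log (H / r) / lam + lam * T * ((2 * H + 1) * n) ^ 2 / 2 +
        (2 * H + 1) * n * ∫ ω, g ω ∂P := by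
        rw [integral_add (integrable_const _) (hgi.const_mul _), integral_const_mul]
        simp
    _ ≤ _ := by gcongr

end SmoothGameSequence

/-! ### Choice of scale and step size. -/

/-- The exponential factor `2 ^ n` costs only `n` after the logarithm; the remaining factors are
polynomial. -/
theorem log_two_add_mul_two_pow_le {n T : ℕ} {H κ : ℝ} (hH : 0 ≤ H) (hκ : 0 ≤ κ) :
    Real.log (2 + H * κ * (2 ^ n * n) * T) ≤ n + 4 * Real.log (2 + n + T + H + κ) := by
  set x : ℝ := 2 + n + T + H + κ with hx
  have hn0 : (0 : ℝ) ≤ n := n.cast_nonneg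
  have hT0 : (0 : ℝ) ≤ T := T.cast_nonneg
  have hx2 : 2 ≤ x := by rw [hx]; linarith
  have h1 : H * κ * n * T ≤ (x - 2) ^ 4 := by
    calc H * κ * n * T ≤ (x - 2) * (x - 2) * (x - 2) * (x - 2) := by
          gcongr <;> first | positivity | linarith
      _ = (x - 2) ^ 4 := by ring
  have h2 : 2 + (x - 2) ^ 4 ≤ x ^ 4 := by
    obtain ⟨y, hy⟩ : ∃ y, y = x - 2 := ⟨_, rfl⟩
    have hy0 : 0 ≤ y := by linarith
    rw [show x = y + 2 by linarith, add_sub_cancel_right]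
    have : 0 ≤ 8 * y ^ 3 + 24 * y ^ 2 + 32 * y := by positivity
    nlinarith
  have h3 : (1 : ℝ) ≤ 2 ^ n := one_le_pow₀ one_le_two
  have h4 : 2 + H * κ * (2 ^ n * n) * T ≤ 2 ^ n * x ^ 4 := by
    calc 2 + H * κ * (2 ^ n * n) * T = 2 + 2 ^ n * (H * κ * n * T) := by ring
      _ ≤ 2 ^ n * 2 + 2 ^ n * (x - 2) ^ 4 := by gcongr; linarith
      _ = 2 ^ n * (2 + (x - 2) ^ 4) := by ring
      _ ≤ _ := by gcongr
  calc Real.log (2 + H * κ * (2 ^ n * n) * T) ≤ Real.log (2 ^ n * x ^ 4) :=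
        Real.log_le_log (by positivity) h4
    _ = n * Real.log 2 + 4 * Real.log x := by
        rw [Real.log_mul (by positivity) (by positivity), Real.log_pow, Real.log_pow]
        norm_num
    _ ≤ n + 4 * Real.log x := by nlinarith [Real.log_two_lt_d9]

theorem one_le_log_of_three_le {x : ℝ} (hx : 3 ≤ x) : 1 ≤ Real.log x := by
  rw [Real.le_log_iff_exp_le (by linarith)]
  linarith [Real.exp_one_lt_d9]

/-- The step size of the Exponential Forecaster. -/
def forecasterStep (n T : ℕ) (H κ : ℝ) : ℝ :=
  Real.sqrt (Real.log (2 + H * κ * (2 ^ n * n) * T)) / (Real.sqrt T * ((2 * H + 1) * n))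

theorem SmoothGameSequence.expected_regret_forecasterStep_le {n T : ℕ} {H κ : ℝ} {Ω : Type*}
    [MeasurableSpace Ω] {P : Measure Ω} [IsProbabilityMeasure P]
    (𝒢 : SmoothGameSequence n T H κ P) (hH : 0 < H) (hκ : 0 < κ) (hn : 0 < n) (hnT : n ≤ T) :
    ∫ ω, (∫ σ, regret H (𝒢.loss ω) σ
        ∂(expForecasterPlay H (forecasterStep n T H κ) (𝒢.loss ω))) ∂P ≤
      14 * ((2 * H + 1) * n) * Real.sqrt (n * T) * Real.log (2 + n + T + H + κ) := by
  have hn1 : (1 : ℝ) ≤ n := Nat.one_le_cast.2 hn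
  have hnT' : (n : ℝ) ≤ T := Nat.cast_le.2 hnT
  have hT0 : (0 : ℝ) < T := by linarith
  set R : ℝ := (2 * H + 1) * n with hR
  have hR0 : 0 < R := by positivity
  set l := Real.log (2 + n + T + H + κ) with hl
  have hl1 : 1 ≤ l := one_le_log_of_three_le (by linarith)
  set D : ℝ := H * κ * (2 ^ n * n) * T with hD
  have hD0 : 0 < D := by positivity
  set A := Real.log (2 + D) with hA
  have hA0 : 0 < A := Real.log_pos (by linarith)
  have hAl : A ≤ 5 * (n * l) := by
    have h : A ≤ n + 4 * l := log_two_add_mul_two_pow_le hH.le hκ.le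
    nlinarith
  have hlam : forecasterStep n T H κ = Real.sqrt A / (Real.sqrt T * R) := rfl
  set a := Real.sqrt A with ha
  set b := Real.sqrt T with hb
  have ha0 : 0 < a := Real.sqrt_pos.2 hA0
  have hb0 : 0 < b := Real.sqrt_pos.2 hT0
  have haA : a ^ 2 = A := Real.sq_sqrt hA0.le
  have hbT : b ^ 2 = T := Real.sq_sqrt hT0.le
  -- With `r = H / (1 + D)` the logarithms become `log (1 + D)` and `log (2 + D)`, and the expected
  -- count contributes `4 * D / (1 + D) ≤ 4`; the summand `1` ensures `r ≤ H`.
  have hr : 0 < H / (1 + D) := by positivity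
  have hrH : H / (1 + D) ≤ H := div_le_self hH.le (by linarith)
  have hmain := 𝒢.expected_regret_le hH hκ.le (lam := a / (b * R)) (by positivity) hr hrH
  rw [hlam]
  refine hmain.trans ?_
  rw [← hR, div_div_cancel₀ hH.ne', show 1 + D + 1 = 2 + D by ring, ← hA]
  have e1 : Real.log (1 + D) / (a / (b * R)) ≤ R * (a * b) := by
    have h : Real.log (1 + D) ≤ A := Real.log_le_log (by linarith) (by linarith)
    rw [div_le_iff₀ (by positivity)]
    calc _ ≤ A := h
      _ = R * (a * b) * (a / (b * R)) := by rw [← haA]; field_simp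
  have e2 : a / (b * R) * T * R ^ 2 / 2 = R * (a * b) / 2 := by
    rw [← hbT]; field_simp
  have e3 : 2 ^ n * n * κ * (H / (1 + D)) * T ≤ 1 := by
    rw [show 2 ^ n * n * κ * (H / (1 + D)) * T = D / (1 + D) by rw [hD]; ring]
    exact (div_le_one (by linarith)).2 (by linarith)
  set q := Real.sqrt (n * T) with hq
  -- This is where `n ≤ T` is needed: the additive term of order `n * l` is dominated by `q * l`.
  have hqn : (n : ℝ) ≤ q := Real.le_sqrt_of_sq_le (by nlinarith)
  have hab : a * b ≤ 3 * (q * l) := by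
    rw [ha, hb, ← Real.sqrt_mul hA0.le]
    refine Real.sqrt_le_iff.2 ⟨by positivity, ?_⟩
    have hqq : q ^ 2 = n * T := Real.sq_sqrt (by positivity)
    calc A * T ≤ 5 * (n * l) * T := by gcongr
      _ ≤ 9 * (n * T) * (l * l) := by
        have : (n * T) * l ≤ (n * T) * (l * l) := by gcongr; nlinarith
        have : 0 ≤ (n * T) * (l * l) := by positivity
        linarith
      _ = (3 * (q * l)) ^ 2 := by rw [mul_pow, mul_pow, hqq]; ring
  have hnl : n * l ≤ q * l := by gcongr
  have hnl1 : 1 ≤ n * l := by nlinarith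
  -- In units of `q * l` the terms are at most `3 + 3/2 + 5 + 4 = 13.5`.
  have hfin : a * b + a * b / 2 + (A + 4 * (2 ^ n * n * κ * (H / (1 + D)) * T)) ≤ 14 * (q * l) := by
    linarith
  calc _ ≤ R * (a * b) + R * (a * b) / 2 + R * (A + 4 * (2 ^ n * n * κ * (H / (1 + D)) * T)) := by
        rw [e2]; gcongr
    _ = R * (a * b + a * b / 2 + (A + 4 * (2 ^ n * n * κ * (H / (1 + D)) * T))) := by ring
    _ ≤ R * (14 * (q * l)) := by gcongr
    _ = _ := by ring

theorem mul_le_mul_sqrt_mul_log {n T : ℕ} {H κ : ℝ} (hH : 0 ≤ H) (hκ : 0 ≤ κ)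
    (h : n = 0 ∨ T ≤ n) :
    T * ((2 * H + 1) * n) ≤
      14 * ((2 * H + 1) * n) * Real.sqrt (n * T) * Real.log (2 + n + T + H + κ) := by
  rcases Nat.eq_zero_or_pos n with rfl | hn
  · simp
  have hTn : (T : ℝ) ≤ n := Nat.cast_le.2 (h.resolve_left hn.ne')
  have hn1 : (1 : ℝ) ≤ n := Nat.one_le_cast.2 hn
  have hT0 : (0 : ℝ) ≤ T := T.cast_nonneg
  have hl : 1 ≤ Real.log (2 + n + T + H + κ) := one_le_log_of_three_le (by linarith)
  have hq : (T : ℝ) ≤ Real.sqrt (n * T) := Real.le_sqrt_of_sq_le (by nlinarith)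
  calc (T : ℝ) * ((2 * H + 1) * n) ≤ Real.sqrt (n * T) * ((2 * H + 1) * n) := by gcongr
    _ = 1 * ((2 * H + 1) * n) * Real.sqrt (n * T) * 1 := by ring
    _ ≤ _ := by gcongr; norm_num

end

theorem mainTheorem9 :
    (∀ (n : ℕ) (H κ : ℝ), 0 < H → 0 < κ → ∃ (c : ℝ) (p : ℕ), 0 < c ∧
      ∀ (T : ℕ) (Ω : Type*) [MeasurableSpace Ω] (P : Measure Ω) [IsProbabilityMeasure P]
        (𝒢 : SmoothGameSequence n T H κ P),
        IsDispersed P (Icc 0 H) (1 / 2) 0 c p 𝒢.loss) ∧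
    (∃ (c : ℝ) (p : ℕ), 0 < c ∧
      ∀ (n T : ℕ) (H κ : ℝ), 0 < H → 0 < κ → ∃ lam : ℝ, 0 < lam ∧
        ∀ (Ω : Type*) [MeasurableSpace Ω] (P : Measure Ω) [IsProbabilityMeasure P]
          (𝒢 : SmoothGameSequence n T H κ P),
          (∀ᵐ ω ∂P, Integrable (regret H (𝒢.loss ω)) (expForecasterPlay H lam (𝒢.loss ω))) ∧
          Integrable
            (fun ω => ∫ σ, regret H (𝒢.loss ω) σ ∂(expForecasterPlay H lam (𝒢.loss ω))) P ∧
          ∫ ω, (∫ σ, regret H (𝒢.loss ω) σ ∂(expForecasterPlay H lam (𝒢.loss ω))) ∂P ≤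
            c * ((2 * H + 1) * n) * Real.sqrt (n * T)
              * Real.log (2 + n + T + H + κ) ^ p) := by
  refine ⟨fun n H κ hH hκ => ⟨H + 4 * (2 ^ n * n * κ), 0, by positivity,
    fun T Ω _ P _ 𝒢 => 𝒢.isDispersed_loss hH.le hκ.le⟩, 14, 1, by norm_num,
    fun n T H κ hH hκ => ?_⟩
  suffices h : ∃ lam : ℝ, 0 < lam ∧
      ∀ (Ω : Type _) [MeasurableSpace Ω] (P : Measure Ω) [IsProbabilityMeasure P]
        (𝒢 : SmoothGameSequence n T H κ P),
        ∫ ω, (∫ σ, regret H (𝒢.loss ω) σ ∂(expForecasterPlay H lam (𝒢.loss ω))) ∂P ≤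
          14 * ((2 * H + 1) * n) * Real.sqrt (n * T) * Real.log (2 + n + T + H + κ) by
    obtain ⟨lam, hlam, h⟩ := h
    refine ⟨lam, hlam, fun Ω _ P _ 𝒢 => ⟨𝒢.range.mono fun ω hω =>
      integrable_regret hH hlam.le (𝒢.measurable_loss_right ω) hω,
      𝒢.integrable_integral_regret hH hlam.le, ?_⟩⟩
    rw [pow_one]
    exact h Ω P 𝒢
  -- In the degenerate case any positive step size works; `forecasterStep` would vanish for `n = 0`
  -- or `T = 0`.
  by_cases h : n = 0 ∨ T ≤ n
  · exact ⟨1, one_pos, fun Ω _ P _ 𝒢 =>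
      (𝒢.expected_regret_le_mul hH zero_le_one).trans (mul_le_mul_sqrt_mul_log hH.le hκ.le h)⟩
  · push Not at h
    have hn : 0 < n := Nat.pos_of_ne_zero h.1
    refine ⟨forecasterStep n T H κ, ?_, fun Ω _ P _ 𝒢 =>
      𝒢.expected_regret_forecasterStep_le hH hκ hn h.2.le⟩
    have hT : (0 : ℝ) < T := Nat.cast_pos.2 (hn.trans h.2)
    have hn' : (0 : ℝ) < n := Nat.cast_pos.2 hn
    have hD : 0 < H * κ * (2 ^ n * n) * T := by positivity
    have hA : 0 < Real.log (2 + H * κ * (2 ^ n * n) * T) := Real.log_pos (by linarith)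
    unfold forecasterStep
    positivity
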